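/- Let $n\ge 1$ and give $\mathbb{R}^n$ the standard inner product $\langle\cdot,\cdot\rangle$. Let $Q\subseteq\mathbb{R}^n$ be a proper polyhedral cone, that is, a closed convex cone (containing $0$) that is generated by a finite set of vectors, is pointed ($Q\cap(-Q)=\{0\}$) and has nonempty interior. Suppose that $Q$ is permutation invariant, that is, $\sigma(Q)=Q$ for every permutation $\sigma$ of the coordinates. Call $Q$ reducible if $Q=K_1+K_2$ for some nonempty sets $K_1,K_2\subseteq\mathbb{R}^n$, both different from $\{0\}$, with $\operatorname{span}(K_1)\cap\operatorname{span}(K_2)=\{0\}$, and irreducible if it is nonzero and not reducible. Let $Q^*=\{s\in\mathbb{R}^n:\langle x,s\rangle\ge 0\ \text{for all } x\in Q\}$, and let the Lyapunov rank $\beta(Q)$ be the dimension of the real vector space of all linear maps $L:\mathbb{R}^n\to\mathbb{R}^n$ that are Lyapunov-like on $Q$, that is, satisfy $\langle L(x),s\rangle=0$ whenever $x\in Q$, $s\in Q^*$ and $\langle x,s\rangle=0$. Then either (a) $Q$ is irreducible, in which case $\beta(Q)=1$; or (b) $Q$ is reducible, in which case $Q$ is isomorphic to $\mathbb{R}^n_+$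 (there is an invertible linear map $T:\mathbb{R}^n\to\mathbb{R}^n$ with $T(Q)=\mathbb{R}^n_+$) and $\beta(Q)=n$. -/

import Mathlib

open scoped Pointwise RealInnerProductSpace

namespace PermCone

section General

variable {V : Type*} [NormedAddCommGroup V] [InnerProductSpace ℝ V]

/-- Proper cone: a closed convex cone that is pointed (`K ∩ (-K) = {0}`) and solid
(nonempty interior). A Mathlib `PointedCone ℝ V` is a convex cone containing `0`, that is, a
nonempty set closed under `t x + s y` with `t, s ≥ 0`. -/
structure IsProper (K : PointedCone ℝ V) : Prop where
  closed : IsClosed (K : Set V)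
  pointed : (K : Set V) ∩ -(K : Set V) = {0}
  solid : (interior (K : Set V)).Nonempty

/-- Polyhedral cone: a closed convex cone that is the conic hull of a finite set. -/
structure IsPolyhedral (K : PointedCone ℝ V) : Prop where
  closed : IsClosed (K : Set V)
  finGen : ∃ S : Finset V, K = PointedCone.hull ℝ (S : Set V)

/-- Reducible cone: `K = K₁ + K₂` for nonempty sets `K₁, K₂`, both different from `{0}`, whose
linear spans meet only in `0`. -/
def IsReducible (K : PointedCone ℝ V) : Prop :=
  ∃ K₁ K₂ : Set V, K₁.Nonempty ∧ K₂.Nonempty ∧ K₁ ≠ {0} ∧ K₂ ≠ {0} ∧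
    (K : Set V) = K₁ + K₂ ∧ Submodule.span ℝ K₁ ⊓ Submodule.span ℝ K₂ = ⊥

/-- Irreducible cone: a nonzero convex cone that is not reducible. -/
def IsIrreducible (K : PointedCone ℝ V) : Prop :=
  K ≠ ⊥ ∧ ¬ IsReducible K

/-- Two cones are isomorphic if an invertible linear map carries one onto the other. -/
def IsIsomorphic {W : Type*} [NormedAddCommGroup W] [InnerProductSpace ℝ W]
    (K : PointedCone ℝ V) (K' : PointedCone ℝ W) : Prop :=
  ∃ T : V ≃ₗ[ℝ] W, T '' (K : Set V) = (K' : Set W)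

/-- `L` is Lyapunov-like on `K`: if `x ∈ K`, `s ∈ K*` and `⟪x, s⟫ = 0`, then `⟪L x, s⟫ = 0`. -/
def IsLyapunovLike [CompleteSpace V] (K : PointedCone ℝ V) (L : V →ₗ[ℝ] V) : Prop :=
  ∀ x ∈ K, ∀ s ∈ ProperCone.innerDual (K : Set V), ⟪x, s⟫ = 0 → ⟪L x, s⟫ = 0

/-- The real vector space of all Lyapunov-like transformations on `K`. -/
def lyapunovLike [CompleteSpace V] (K : PointedCone ℝ V) : Submodule ℝ (V →ₗ[ℝ] V) where
  carrier := {L | IsLyapunovLike K L}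
  zero_mem' := fun x _ s _ _ => by simp
  add_mem' := fun {L M} hL hM x hx s hs h => by
    rw [LinearMap.add_apply, inner_add_left, hL x hx s hs h, hM x hx s hs h, add_zero]
  smul_mem' := fun c L hL x hx s hs h => by
    rw [LinearMap.smul_apply, real_inner_smul_left, hL x hx s hs h, mul_zero]

/-- The Lyapunov rank of `K`. -/
noncomputable def lyapunovRank [CompleteSpace V] (K : PointedCone ℝ V) : ℕ :=
  Module.finrank ℝ (lyapunovLike K)

end General

/-- The action of a permutation `σ` of the indices on `ℝⁿ` by permuting coordinates
(the permutation matrix of `σ`). -/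
noncomputable def permMap {n : ℕ} (σ : Equiv.Perm (Fin n)) :
    EuclideanSpace ℝ (Fin n) ≃ₗᵢ[ℝ] EuclideanSpace ℝ (Fin n) :=
  LinearIsometryEquiv.piLpCongrLeft 2 ℝ ℝ σ

/-- `σ(Q) = Q` for every permutation `σ`. -/
def IsPermInvariant {n : ℕ} (Q : PointedCone ℝ (EuclideanSpace ℝ (Fin n))) : Prop :=
  ∀ σ : Equiv.Perm (Fin n),
    permMap σ '' (Q : Set (EuclideanSpace ℝ (Fin n))) = (Q : Set (EuclideanSpace ℝ (Fin n)))

/-- The nonnegative orthant of `ℝⁿ`. -/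
def nonnegOrthant (n : ℕ) : PointedCone ℝ (EuclideanSpace ℝ (Fin n)) where
  carrier := {x | ∀ i, 0 ≤ x i}
  zero_mem' := fun i => by simp
  add_mem' := fun {x y} hx hy i => by
    rw [PiLp.add_apply]
    exact add_nonneg (hx i) (hy i)
  smul_mem' := fun c x hx i => mul_nonneg c.2 (hx i)

end PermCone

/-! The link between the cone and its Lyapunov-like maps is `exists_eigenvalue`: by Farkas' lemma,
every irredundant generator of a proper polyhedral cone is an eigenvector of every Lyapunov-like
map.

If the eigenvalues of one map differed, separating the generators by eigenvalue would decompose the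
cone, since eigenspaces are independent. So without a decomposition every Lyapunov-like map is
scalar and the rank is 1.

If Q is reducible, the projection P onto the span of one summand is Lyapunov-like. Symmetrising a
vector of a summand and using pointedness shows that the all-ones vector lies in neither span
(`ones_notMem_span`), so P does not send it to a multiple of itself. The images of the all-ones
vector under Lyapunov-like maps form a permutation invariant subspace, because conjugating by
permutations preserves these maps. It contains the all-ones vector and a nonconstant vector, hence
is all of ℝⁿ, and the rank is at least n.

Conversely, a basis chosen among the generators diagonalises all Lyapunov-like maps at once, so the
rank is at most n. Equality makes every diagonal map available, in particular the coordinate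
projections, and these force each generator onto a ray of the basis. -/

namespace PermCone

/-! ### Farkas' lemma -/

section Farkas

/-- **Farkas' lemma** for finitely many linear functionals, in its algebraic form. -/
theorem mem_hull_image_of_forall_nonneg {W ι : Type*} [AddCommGroup W] [Module ℝ W]
    (s : Finset ι) (a : ι → W →ₗ[ℝ] ℝ) (g : W →ₗ[ℝ] ℝ)
    (h : ∀ x, (∀ i ∈ s, 0 ≤ a i x) → 0 ≤ g x) : g ∈ PointedCone.hull ℝ (a '' s) := by
  classical
  induction s using Finset.induction_on generalizing a g with
  | empty =>
    have : g = 0 := by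
      ext x
      have h1 := h x (by simp)
      have h2 := h (-x) (by simp)
      rw [map_neg] at h2
      simpa using le_antisymm (by linarith) h1
    simp [this]
  | insert j s _ ih =>
    have hsub : a '' (s : Set ι) ⊆ a '' ((insert j s : Finset ι) : Set ι) :=
      Set.image_mono (by simp)
    by_cases hg : ∀ x, (∀ i ∈ s, 0 ≤ a i x) → 0 ≤ g x
    · exact Submodule.span_mono hsub (ih a g hg)
    push Not at hg
    obtain ⟨z, hz, hgz⟩ := hg
    have hjz : a j z < 0 := by
      by_contra! hj
      exact hgz.not_ge (h z (by simpa using ⟨hj, hz⟩))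
    -- The vector `z` witnesses that `a j` cannot be dropped. Rescaled so that `a j y = -1`, it
    -- makes `x ↦ x + a j x • y` a projection onto the kernel of `a j`.
    obtain ⟨y, hy, hgy, hjy⟩ : ∃ y, (∀ i ∈ s, 0 ≤ a i y) ∧ g y ≤ 0 ∧ a j y = -1 := by
      refine ⟨(-(a j z))⁻¹ • z, fun i hi => ?_, ?_, ?_⟩
      · rw [map_smul]
        exact mul_nonneg (inv_nonneg.2 (by linarith)) (hz i hi)
      · rw [map_smul]
        exact mul_nonpos_of_nonneg_of_nonpos (inv_nonneg.2 (by linarith)) hgz.le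
      · rw [map_smul, smul_eq_mul]
        field_simp [hjz.ne]
    -- These functionals are `a i` and `g` composed with that projection. On its image the
    -- constraint `a j` holds trivially, so the induction hypothesis for `s` applies.
    have key := ih (fun i => a i + a i y • a j) (g + g y • a j) (fun x hx => by
      have := h (x + a j x • y) (fun i hi => by
        rcases Finset.mem_insert.1 hi with rfl | hi
        · simp [hjy]
        · have := hx i hi
          simp only [LinearMap.add_apply, LinearMap.smul_apply, smul_eq_mul, map_add,
            map_smul] at this ⊢
          linarith)
      simp only [LinearMap.add_apply, LinearMap.smul_apply, smul_eq_mul, map_add,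
        map_smul] at this ⊢
      linarith)
    have hj : a j ∈ PointedCone.hull ℝ (a '' ((insert j s : Finset ι) : Set ι)) :=
      Submodule.subset_span ⟨j, by simp, rfl⟩
    have hle : PointedCone.hull ℝ ((fun i => a i + a i y • a j) '' (s : Set ι)) ≤
        PointedCone.hull ℝ (a '' ((insert j s : Finset ι) : Set ι)) := by
      refine Submodule.span_le.2 ?_
      rintro _ ⟨i, hi, rfl⟩
      exact add_mem (Submodule.subset_span (hsub ⟨i, hi, rfl⟩))
        (PointedCone.smul_mem _ (hy i hi) hj)
    have := add_mem (hle key) (PointedCone.smul_mem _ (neg_nonneg.2 hgy) hj)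
    simpa using this

variable {V : Type*} [NormedAddCommGroup V] [InnerProductSpace ℝ V]

/-- A vector that is nonnegative on the dual of a finite set lies in its conic hull. -/
theorem mem_hull_of_forall_inner_nonneg (S : Finset V) (y : V)
    (h : ∀ s, (∀ x ∈ S, 0 ≤ ⟪x, s⟫) → 0 ≤ ⟪y, s⟫) : y ∈ PointedCone.hull ℝ (S : Set V) := by
  have key := mem_hull_image_of_forall_nonneg S (fun x => innerₗ V x) (innerₗ V y)
    (fun s hs => h s hs)
  have himg : (PointedCone.hull ℝ (S : Set V)).map (innerₗ V) =
      PointedCone.hull ℝ ((fun x => innerₗ V x) '' (S : Set V)) :=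
    Submodule.map_span _ _
  rw [← himg] at key
  obtain ⟨x, hx, hxy⟩ := key
  have : x = y := ext_inner_right ℝ fun v => by simpa using congrArg (fun f => f v) hxy
  exact this ▸ hx

end Farkas

/-! ### Generators, decompositions and Lyapunov-like maps of proper cones -/

section General

variable {V : Type*} [NormedAddCommGroup V] [InnerProductSpace ℝ V] {K : PointedCone ℝ V}

theorem IsProper.eq_zero_of_neg_mem (hK : IsProper K) {x : V} (hx : x ∈ K) (hx' : -x ∈ K) :
    x = 0 := by
  have : x ∈ (K : Set V) ∩ -(K : Set V) := ⟨hx, hx'⟩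
  rwa [hK.pointed] at this

theorem IsProper.span_eq_top (hK : IsProper K) : Submodule.span ℝ (K : Set V) = ⊤ := by
  refine Submodule.eq_top_of_nonempty_interior' _ ?_
  exact hK.solid.mono (interior_mono Submodule.subset_span)

theorem span_hull (S : Set V) :
    Submodule.span ℝ (PointedCone.hull ℝ S : Set V) = Submodule.span ℝ S :=
  le_antisymm (Submodule.span_le.2 (PointedCone.hull_le_span ℝ S))
    (Submodule.span_mono Submodule.subset_span)

theorem IsProper.span_eq_top_of_hull (hK : IsProper K) {S : Set V}
    (hS : K = PointedCone.hull ℝ S) : Submodule.span ℝ S = ⊤ := by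
  rw [← hK.span_eq_top, hS, span_hull]

/-- A polyhedral cone has a finite set of generators none of which is redundant. -/
theorem IsPolyhedral.exists_minimal_generators (hK : IsPolyhedral K) :
    ∃ S : Finset V, K = PointedCone.hull ℝ (S : Set V) ∧
      ∀ x ∈ S, x ∉ PointedCone.hull ℝ ((S : Set V) \ {x}) := by
  classical
  obtain ⟨S, hS, hmin⟩ := exists_minimal_of_wellFoundedLT
    (fun S : Finset V => K = PointedCone.hull ℝ (S : Set V)) hK.finGen
  refine ⟨S, hS, fun x hx hmem => ?_⟩
  have hle : PointedCone.hull ℝ (S : Set V) ≤ PointedCone.hull ℝ ((S : Set V) \ {x}) := by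
    refine Submodule.span_le.2 fun y hy => ?_
    by_cases hyx : y = x
    · exact hyx ▸ hmem
    · exact Submodule.subset_span ⟨hy, hyx⟩
  have hK' : K = PointedCone.hull ℝ ((S.erase x : Finset V) : Set V) := by
    rw [Finset.coe_erase, hS]
    exact le_antisymm hle (Submodule.span_mono Set.sdiff_subset)
  exact Finset.notMem_erase x S (hmin hK' (Finset.erase_subset x S) hx)

/-- An irredundant generator of a proper cone is extreme. -/
theorem IsProper.exists_eq_smul_of_add_eq_smul (hK : IsProper K) {S : Set V}
    (hS : K = PointedCone.hull ℝ S) {x : V} (hx : x ∈ S)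
    (hxS : x ∉ PointedCone.hull ℝ (S \ {x})) {q q' : V} (hq : q ∈ K) (hq' : q' ∈ K) {c : ℝ}
    (h : q + q' = c • x) : ∃ a : ℝ, q = a • x := by
  have hxK : x ∈ K := hS ▸ Submodule.subset_span hx
  have hSx : insert x (S \ {x}) = S := by simp [hx]
  have hsub : PointedCone.hull ℝ (S \ {x}) ≤ K := hS ▸ Submodule.span_mono Set.sdiff_subset
  rw [hS, ← hSx] at hq hq'
  obtain ⟨⟨a, ha⟩, u, hu, rfl⟩ := Submodule.mem_span_insert.1 hq
  obtain ⟨⟨b, hb⟩, u', hu', rfl⟩ := Submodule.mem_span_insert.1 hq'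
  simp only [Nonneg.mk_smul] at h
  have hsum : u + u' = (c - a - b) • x := by
    rw [sub_smul, sub_smul, ← h]; abel
  -- A positive coefficient would put `x` in the hull of the other generators. Otherwise `-u` lies
  -- in `K`, and pointedness gives `u = 0`.
  rcases lt_or_ge 0 (c - a - b) with hpos | hneg
  · exact absurd ((PointedCone.smul_mem_iff _ hpos).1 (hsum ▸ add_mem hu hu')) hxS
  · have hu0 : u = 0 := by
      refine hK.eq_zero_of_neg_mem (hsub hu) ?_
      have : -u = u' + (-(c - a - b)) • x := by
        rw [neg_smul, ← hsum]; abel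
      rw [this]
      exact add_mem (hsub hu') (PointedCone.smul_mem _ (neg_nonneg.2 hneg) hxK)
    exact ⟨a, by simp [hu0]⟩

/-- The two parts of a reducible decomposition of a cone contain the origin. -/
theorem zero_mem_of_eq_add {K₁ K₂ : Set V} (hK : (K : Set V) = K₁ + K₂)
    (hd : Submodule.span ℝ K₁ ⊓ Submodule.span ℝ K₂ = ⊥) :
    (0 : V) ∈ K₁ ∧ (0 : V) ∈ K₂ := by
  have h0 : (0 : V) ∈ K₁ + K₂ := hK ▸ K.zero_mem
  obtain ⟨x, hx, y, hy, hxy⟩ := Set.mem_add.1 h0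
  have hx2 : x ∈ Submodule.span ℝ K₂ := by
    rw [eq_neg_of_add_eq_zero_left hxy]
    exact neg_mem (Submodule.subset_span hy)
  have hx0 : x = 0 := by
    have : x ∈ Submodule.span ℝ K₁ ⊓ Submodule.span ℝ K₂ := ⟨Submodule.subset_span hx, hx2⟩
    simpa [hd] using this
  have hy0 : y = 0 := by simpa [hx0] using hxy
  exact ⟨hx0 ▸ hx, hy0 ▸ hy⟩

theorem subset_left_of_eq_add {K₁ K₂ : Set V} (hK : (K : Set V) = K₁ + K₂)
    (hd : Submodule.span ℝ K₁ ⊓ Submodule.span ℝ K₂ = ⊥) : K₁ ⊆ K := fun x hx => by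
  rw [hK]
  exact ⟨x, hx, 0, (zero_mem_of_eq_add hK hd).2, by simp⟩

theorem subset_right_of_eq_add {K₁ K₂ : Set V} (hK : (K : Set V) = K₁ + K₂)
    (hd : Submodule.span ℝ K₁ ⊓ Submodule.span ℝ K₂ = ⊥) : K₂ ⊆ K := fun x hx => by
  rw [hK]
  exact ⟨0, (zero_mem_of_eq_add hK hd).1, x, hx, by simp⟩

/-- Solidity makes the two spans fill the space, so the projection onto one along the other is
defined. -/
theorem IsProper.isCompl_span (hK : IsProper K) {K₁ K₂ : Set V} (hadd : (K : Set V) = K₁ + K₂)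
    (hd : Submodule.span ℝ K₁ ⊓ Submodule.span ℝ K₂ = ⊥) :
    IsCompl (Submodule.span ℝ K₁) (Submodule.span ℝ K₂) := by
  refine IsCompl.of_eq hd (top_le_iff.1 ?_)
  rw [← hK.span_eq_top, hadd]
  refine Submodule.span_le.2 ?_
  rintro _ ⟨x, hx, y, hy, rfl⟩
  exact Submodule.add_mem_sup (Submodule.subset_span hx) (Submodule.subset_span hy)

variable [CompleteSpace V]

/-- An irredundant generator of a proper cone is an eigenvector of each Lyapunov-like map. -/
theorem IsProper.exists_eigenvalue (hK : IsProper K) {S : Finset V}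
    (hS : K = PointedCone.hull ℝ (S : Set V)) {x : V} (hx : x ∈ S)
    (hxS : x ∉ PointedCone.hull ℝ ((S : Set V) \ {x})) {L : V →ₗ[ℝ] V}
    (hL : IsLyapunovLike K L) : ∃ μ : ℝ, L x = μ • x := by
  classical
  have hxK : x ∈ K := hS ▸ Submodule.subset_span hx
  -- Adjoining `-x` to the generators forces a dual vector to be orthogonal to `x`, and there the
  -- Lyapunov-like condition makes `⟪L x, s⟫` vanish. Farkas' lemma thus puts both `L x` and `-L x`
  -- in `K + ℝ x`. Adding the two expressions and using that `x` is extreme yields the eigenvalue.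
  have aux : ∀ ε : ℝ, ∃ a : ℝ, ∃ q ∈ K, ε • L x = a • x + q := by
    intro ε
    have : ε • L x ∈ PointedCone.hull ℝ ((insert (-x) S : Finset V) : Set V) := by
      refine mem_hull_of_forall_inner_nonneg _ _ fun s hs => ?_
      have hsS : ∀ y ∈ S, 0 ≤ ⟪y, s⟫ := fun y hy => hs y (Finset.mem_insert_of_mem hy)
      have hsK : s ∈ ProperCone.innerDual (K : Set V) := by
        intro y hy
        have hy' : y ∈ K := hy
        rw [hS] at hy'
        change 0 ≤ ⟪y, s⟫
        clear hy
        induction hy' using Submodule.span_induction with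
        | mem y hy => exact hsS y hy
        | zero => simp
        | add y z _ _ h1 h2 =>
          rw [inner_add_left]
          exact add_nonneg h1 h2
        | smul c y _ h =>
          change 0 ≤ ⟪(c : ℝ) • y, s⟫
          rw [real_inner_smul_left]
          exact mul_nonneg c.2 h
      have h1 := hs (-x) (Finset.mem_insert_self _ _)
      rw [inner_neg_left] at h1
      have h0 : ⟪x, s⟫ = 0 := le_antisymm (by linarith) (hsS x hx)
      rw [real_inner_smul_left, hL x hxK s hsK h0, mul_zero]
    rw [Finset.coe_insert] at this
    obtain ⟨⟨a, ha⟩, q, hq, h⟩ := Submodule.mem_span_insert.1 this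
    exact ⟨-a, q, by rw [hS]; exact hq, by rw [h, Nonneg.mk_smul, smul_neg, neg_smul]⟩
  obtain ⟨a, q, hq, h⟩ := aux 1
  obtain ⟨b, q', hq', h'⟩ := aux (-1)
  rw [one_smul] at h
  rw [neg_one_smul] at h'
  obtain ⟨c, hc⟩ := hK.exists_eq_smul_of_add_eq_smul hS hx hxS hq hq' (c := -a - b) (by
    rw [sub_smul, neg_smul, sub_eq_add_neg]
    have h1 : q = L x - a • x := by rw [h]; abel
    have h2 : q' = -L x - b • x := by rw [h']; abel
    rw [h1, h2]; abel)
  exact ⟨a + c, by rw [h, hc, add_smul]⟩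

/-- The projection onto the span of one summand of a decomposition is Lyapunov-like. -/
theorem isLyapunovLike_projection {K₁ K₂ : Set V} (hK : (K : Set V) = K₁ + K₂)
    (hc : IsCompl (Submodule.span ℝ K₁) (Submodule.span ℝ K₂)) :
    IsLyapunovLike K ((Submodule.span ℝ K₁).projection _ hc) := by
  intro x hx s hs hxs
  have hd := hc.inf_eq_bot
  have hx' : x ∈ K₁ + K₂ := hK ▸ hx
  obtain ⟨y, hy, z, hz, rfl⟩ := Set.mem_add.1 hx'
  have h1 : 0 ≤ ⟪y, s⟫ := hs (subset_left_of_eq_add hK hd hy)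
  have h2 : 0 ≤ ⟪z, s⟫ := hs (subset_right_of_eq_add hK hd hz)
  rw [inner_add_left] at hxs
  rw [map_add, Submodule.projection_apply_of_mem_left hc (Submodule.subset_span hy),
    (Submodule.projection_apply_eq_zero_iff hc).2 (Submodule.subset_span hz), add_zero]
  -- Two nonnegative numbers with sum zero both vanish.
  linarith

theorem isLyapunovLike_id : IsLyapunovLike K LinearMap.id := fun _ _ _ _ h => h

/-- Lyapunov-like maps on a proper polyhedral cone that is not reducible are scalar. -/
theorem IsProper.exists_eq_smul_id (hK : IsProper K) (hP : IsPolyhedral K)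
    (hred : ¬ IsReducible K) {L : V →ₗ[ℝ] V} (hL : IsLyapunovLike K L) :
    ∃ μ : ℝ, L = μ • LinearMap.id := by
  obtain ⟨S, hS, hmin⟩ := hP.exists_minimal_generators
  have hspan := hK.span_eq_top_of_hull hS
  have hne : ∀ x ∈ S, x ≠ 0 := fun x hx h0 => hmin x hx (h0 ▸ Submodule.zero_mem _)
  rcases S.eq_empty_or_nonempty with rfl | ⟨x₀, hx₀⟩
  · refine ⟨0, LinearMap.ext fun v => ?_⟩
    have hv : v ∈ Submodule.span ℝ ((∅ : Finset V) : Set V) := hspan ▸ Submodule.mem_top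
    have hv0 : v = 0 := by simpa using hv
    simp [hv0]
  choose! μ hμ using fun x (hx : x ∈ S) => hK.exists_eigenvalue hS hx (hmin x hx) hL
  have hmem : ∀ x ∈ S, x ∈ Module.End.eigenspace L (μ x) := fun x hx =>
    Module.End.mem_eigenspace_iff.2 (hμ x hx)
  by_cases hall : ∀ x ∈ S, μ x = μ x₀
  · refine ⟨μ x₀, LinearMap.ext_on hspan fun x hx => ?_⟩
    rw [hμ x hx, hall x hx]
    rfl
  push Not at hall
  obtain ⟨x₁, hx₁, hne₁⟩ := hall
  -- The generators with eigenvalue `μ x₀` and the remaining ones generate the two summands;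
  -- independence of eigenspaces separates their spans.
  refine absurd ⟨PointedCone.hull ℝ {x ∈ (S : Set V) | μ x = μ x₀},
    PointedCone.hull ℝ {x ∈ (S : Set V) | μ x ≠ μ x₀}, ⟨0, Submodule.zero_mem _⟩,
    ⟨0, Submodule.zero_mem _⟩, fun h => ?_, fun h => ?_, ?_, ?_⟩ hred
  · have : x₀ ∈ ({0} : Set V) := h ▸ Submodule.subset_span ⟨hx₀, rfl⟩
    exact hne x₀ hx₀ this
  · have : x₁ ∈ ({0} : Set V) := h ▸ Submodule.subset_span ⟨hx₁, hne₁⟩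
    exact hne x₁ hx₁ this
  · rw [← Submodule.coe_sup, ← Submodule.span_union, hS]
    congr 2
    ext x
    simp only [Set.mem_union, Set.mem_ofPred_eq, ← and_or_left, em, and_true]
  · have hdis := Module.End.eigenspaces_iSupIndep L (μ x₀)
    refine disjoint_iff.1 (hdis.mono ?_ ?_)
    · refine (span_hull _).trans_le (Submodule.span_le.2 fun x hx => ?_)
      exact hx.2 ▸ hmem x hx.1
    · refine (span_hull _).trans_le (Submodule.span_le.2 fun x hx => ?_)
      exact Submodule.mem_iSup_of_mem (μ x) (Submodule.mem_iSup_of_mem hx.2 (hmem x hx.1))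

theorem IsProper.lyapunovRank_eq_one [Nontrivial V] (hK : IsProper K) (hP : IsPolyhedral K)
    (hred : ¬ IsReducible K) : lyapunovRank K = 1 := by
  have : lyapunovLike K = Submodule.span ℝ {(LinearMap.id : V →ₗ[ℝ] V)} := by
    refine le_antisymm (fun L hL => ?_) ?_
    · obtain ⟨μ, hμ⟩ := hK.exists_eq_smul_id hP hred hL
      exact Submodule.mem_span_singleton.2 ⟨μ, hμ.symm⟩
    · rw [Submodule.span_singleton_le_iff_mem]
      exact isLyapunovLike_id
  rw [lyapunovRank, this]
  refine finrank_span_singleton fun h => ?_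
  obtain ⟨v, hv⟩ := exists_ne (0 : V)
  exact hv (by simpa using congrArg (fun f : V →ₗ[ℝ] V => f v) h)

end General

/-! ### Permutation invariance and the all-ones vector -/

section Permutation

variable {n : ℕ} {Q : PointedCone ℝ (EuclideanSpace ℝ (Fin n))}

@[simp]
theorem permMap_apply (σ : Equiv.Perm (Fin n)) (x : EuclideanSpace ℝ (Fin n)) (i : Fin n) :
    permMap σ x i = x (σ.symm i) := rfl

theorem permMap_symm (σ : Equiv.Perm (Fin n)) : (permMap σ).symm = permMap σ.symm := by
  refine LinearIsometryEquiv.ext fun x => (permMap σ).injective ?_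
  rw [LinearIsometryEquiv.apply_symm_apply]
  ext i
  simp

theorem IsPermInvariant.permMap_mem (hQ : IsPermInvariant Q) (σ : Equiv.Perm (Fin n))
    {x : EuclideanSpace ℝ (Fin n)} (hx : x ∈ Q) : permMap σ x ∈ Q := by
  have : permMap σ x ∈ permMap σ '' (Q : Set (EuclideanSpace ℝ (Fin n))) := ⟨x, hx, rfl⟩
  rwa [hQ σ] at this

/-- Conjugation by permutations preserves Lyapunov-like maps on a permutation invariant cone. -/
theorem IsPermInvariant.isLyapunovLike_conj (hQ : IsPermInvariant Q) (σ : Equiv.Perm (Fin n))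
    {L : EuclideanSpace ℝ (Fin n) →ₗ[ℝ] EuclideanSpace ℝ (Fin n)} (hL : IsLyapunovLike Q L) :
    IsLyapunovLike Q ((permMap σ).toLinearEquiv.toLinearMap ∘ₗ L ∘ₗ
      (permMap σ.symm).toLinearEquiv.toLinearMap) := by
  intro x hx s hs hxs
  -- Permutations act by isometries, so the adjoint is the inverse and the dual cone is invariant as
  -- well.
  have hadj : ∀ y, ⟪permMap σ y, s⟫ = ⟪y, permMap σ.symm s⟫ := fun y => by
    rw [← permMap_symm, ← (permMap σ).inner_map_map y, LinearIsometryEquiv.apply_symm_apply]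
  change ⟪permMap σ (L (permMap σ.symm x)), s⟫ = 0
  rw [hadj]
  refine hL _ (hQ.permMap_mem _ hx) _ (fun y hy => ?_) ?_
  · change 0 ≤ ⟪y, permMap σ.symm s⟫
    rw [← hadj]
    exact hs (hQ.permMap_mem σ hy)
  · rw [← hadj, ← permMap_symm, LinearIsometryEquiv.apply_symm_apply, hxs]

/-- The all-ones vector. -/
noncomputable def ones (n : ℕ) : EuclideanSpace ℝ (Fin n) := WithLp.toLp 2 fun _ => 1

@[simp]
theorem ones_apply (i : Fin n) : ones n i = 1 := rfl

/-- A permutation invariant subspace that contains the all-ones vector and a nonconstant vector is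
the whole space. -/
theorem eq_top_of_permMap_mem {W : Submodule ℝ (EuclideanSpace ℝ (Fin n))}
    (hW : ∀ σ, ∀ w ∈ W, permMap σ w ∈ W) (h1 : ones n ∈ W) {w : EuclideanSpace ℝ (Fin n)}
    (hw : w ∈ W) {i j : Fin n} (hij : w i ≠ w j) : W = ⊤ := by
  have hne : i ≠ j := fun h => hij (h ▸ rfl)
  let e : Fin n → EuclideanSpace ℝ (Fin n) := fun k => EuclideanSpace.single k 1
  have hperm : ∀ σ k, permMap σ (e k) = e (σ k) := fun σ k => by
    ext l
    simp only [permMap_apply, e, PiLp.single_apply]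
    simp [Equiv.symm_apply_eq]
  have hdiff : e i - e j ∈ W := by
    -- Subtracting the transposed vector cancels every coordinate other than `i` and `j`.
    have hsub : w - permMap (Equiv.swap i j) w = (w i - w j) • (e i - e j) := by
      ext l
      simp only [PiLp.sub_apply, permMap_apply, Equiv.symm_swap, PiLp.smul_apply, e,
        PiLp.single_apply, smul_eq_mul]
      rcases eq_or_ne l i with rfl | hli
      · simp [hne]
      rcases eq_or_ne l j with rfl | hlj
      · simp [hne.symm]
      · simp [Equiv.swap_apply_of_ne_of_ne hli hlj, hli, hlj]
    have : (w i - w j) • (e i - e j) ∈ W := hsub ▸ W.sub_mem hw (hW _ w hw)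
    exact (W.smul_mem_iff (sub_ne_zero.2 hij)).1 this
  have hall : ∀ k l, e k - e l ∈ W := by
    intro k l
    rcases eq_or_ne k l with rfl | hkl
    · simp
    obtain ⟨σ, hσi, hσj⟩ : ∃ σ : Equiv.Perm (Fin n), σ i = k ∧ σ j = l := by
      -- The first swap sends `i` to `k`; the second moves the resulting image of `j` to `l` and
      -- fixes `k`.
      refine ⟨Equiv.swap l (Equiv.swap i k j) * Equiv.swap i k, ?_, ?_⟩
      · rw [Equiv.Perm.mul_apply, Equiv.swap_apply_left]
        refine Equiv.swap_apply_of_ne_of_ne hkl fun h => hne ?_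
        rw [← (Equiv.swap i k).injective.eq_iff, Equiv.swap_apply_left]
        exact h
      · rw [Equiv.Perm.mul_apply, Equiv.swap_apply_right]
    have := hW σ _ hdiff
    rwa [map_sub, hperm, hperm, hσi, hσj] at this
  have hn : (n : ℝ) ≠ 0 := by
    have := i.pos
    positivity
  have hone : ones n = ∑ l, e l := by
    ext k
    simp [e]
  have hsingle : ∀ k, e k ∈ W := fun k => by
    have hsum : (n : ℝ) • e k = ones n + ∑ l, (e k - e l) := by
      rw [hone, Finset.sum_sub_distrib]
      simp [← Nat.cast_smul_eq_nsmul ℝ]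
    have : (n : ℝ) • e k ∈ W := hsum ▸ W.add_mem h1 (W.sum_mem fun l _ => hall k l)
    exact (W.smul_mem_iff hn).1 this
  refine eq_top_iff.2 fun v _ => ?_
  have hv : v = ∑ k, v k • e k := by
    ext l
    simp [e, Pi.single_apply]
  rw [hv]
  exact W.sum_mem fun k _ => W.smul_mem _ (hsingle k)

/-- No summand of a decomposition of a permutation invariant cone spans the all-ones vector. -/
theorem IsPermInvariant.ones_notMem_span (hQ : IsPermInvariant Q) (hproper : IsProper Q)
    {K₁ K₂ : Set (EuclideanSpace ℝ (Fin n))} (hne : K₂.Nonempty) (h₂ : K₂ ≠ {0})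
    (hadd : (Q : Set (EuclideanSpace ℝ (Fin n))) = K₁ + K₂)
    (hd : Submodule.span ℝ K₁ ⊓ Submodule.span ℝ K₂ = ⊥) :
    ones n ∉ Submodule.span ℝ K₁ := by
  classical
  intro hones
  obtain ⟨v, hv, hv0⟩ : ∃ v ∈ K₂, v ≠ 0 := by
    by_contra! h
    exact h₂ (hne.subset_singleton_iff.1 h)
  have hvQ := subset_right_of_eq_add hadd hd hv
  -- The sum over the whole orbit is permutation invariant, hence constant.
  obtain ⟨c, hc⟩ : ∃ c : ℝ, ∑ σ, permMap σ v = c • ones n := by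
    obtain hn | ⟨⟨i₀⟩⟩ := isEmpty_or_nonempty (Fin n)
    · exact ⟨0, by ext i; exact hn.elim i⟩
    refine ⟨(∑ σ, permMap σ v) i₀, ?_⟩
    ext i
    simp only [WithLp.ofLp_sum, Finset.sum_apply, permMap_apply, PiLp.smul_apply, ones_apply,
      smul_eq_mul, mul_one]
    refine Fintype.sum_equiv (Equiv.mulLeft (Equiv.swap i i₀)) _ _ fun σ => ?_
    change v (σ.symm i) = v (σ.symm ((Equiv.swap i i₀).symm i₀))
    rw [Equiv.symm_swap, Equiv.swap_apply_right]
  have hr : ∑ σ ∈ Finset.univ.erase (1 : Equiv.Perm (Fin n)), permMap σ v ∈ Q :=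
    sum_mem fun σ _ => hQ.permMap_mem σ hvQ
  have hr' : ∑ σ ∈ Finset.univ.erase (1 : Equiv.Perm (Fin n)), permMap σ v ∈ K₁ + K₂ :=
    hadd ▸ hr
  obtain ⟨k₁, hk₁, k₂, hk₂, hk⟩ := Set.mem_add.1 hr'
  -- The terms other than `v` sum to `k₁ + k₂`. If the all-ones vector were in the span of `K₁`,
  -- then `v + k₂` would lie in both spans and vanish, so `-v = k₂` would be in `Q`, against
  -- pointedness.
  have hsplit : v + k₂ = c • ones n - k₁ := by
    rw [← hc, ← Finset.add_sum_erase _ _ (Finset.mem_univ (1 : Equiv.Perm (Fin n))), ← hk]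
    have : permMap (1 : Equiv.Perm (Fin n)) v = v := rfl
    rw [this]; abel
  have hmem : v + k₂ ∈ Submodule.span ℝ K₁ ⊓ Submodule.span ℝ K₂ := by
    refine ⟨?_, add_mem (Submodule.subset_span hv) (Submodule.subset_span hk₂)⟩
    rw [hsplit]
    exact sub_mem (Submodule.smul_mem _ _ hones) (Submodule.subset_span hk₁)
  rw [hd, Submodule.mem_bot] at hmem
  refine hv0 (hproper.eq_zero_of_neg_mem hvQ ?_)
  rw [neg_eq_of_add_eq_zero_right hmem]
  exact subset_right_of_eq_add hadd hd hk₂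

/-- Lyapunov-like maps on a reducible permutation invariant proper cone carry the all-ones vector
to every vector. -/
theorem IsPermInvariant.map_lyapunovLike_ones_eq_top (hQ : IsPermInvariant Q)
    (hproper : IsProper Q) (hred : IsReducible Q) :
    (lyapunovLike Q).map (LinearMap.applyₗ (ones n)) = ⊤ := by
  obtain ⟨K₁, K₂, hne₁, hne₂, h₁, h₂, hadd, hd⟩ := hred
  have hc := hproper.isCompl_span hadd hd
  have hn₁ := hQ.ones_notMem_span hproper hne₂ h₂ hadd hd
  have hn₂ := hQ.ones_notMem_span hproper hne₁ h₁ (hadd.trans (add_comm _ _))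
    ((inf_comm _ _).trans hd)
  have hinv : ∀ σ, ∀ w ∈ (lyapunovLike Q).map (LinearMap.applyₗ (ones n)),
      permMap σ w ∈ (lyapunovLike Q).map (LinearMap.applyₗ (ones n)) := by
    rintro σ _ ⟨L, hL, rfl⟩
    exact ⟨_, hQ.isLyapunovLike_conj σ hL, rfl⟩
  -- Were the projection of the all-ones vector equal to `c` times it, that vector would lie in the
  -- span of `K₂` for `c = 0` and in the span of `K₁` for `c ≠ 0`.
  obtain ⟨i, j, hij⟩ : ∃ i j, (Submodule.span ℝ K₁).projection _ hc (ones n) i ≠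
      (Submodule.span ℝ K₁).projection _ hc (ones n) j := by
    by_contra! hconst
    obtain hn | ⟨⟨i₀⟩⟩ := isEmpty_or_nonempty (Fin n)
    · have : ones n = 0 := by ext i; exact hn.elim i
      exact hn₁ (this ▸ zero_mem _)
    obtain ⟨c, hP⟩ : ∃ c : ℝ, (Submodule.span ℝ K₁).projection _ hc (ones n) = c • ones n :=
      ⟨(Submodule.span ℝ K₁).projection _ hc (ones n) i₀, by
        ext i
        simpa using hconst i i₀⟩
    rcases eq_or_ne c 0 with rfl | hc0
    · rw [zero_smul] at hP
      exact hn₂ ((Submodule.projection_apply_eq_zero_iff hc).1 hP)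
    · have := Submodule.projection_apply_mem hc (ones n)
      rw [hP] at this
      exact hn₁ ((Submodule.smul_mem_iff _ hc0).1 this)
  exact eq_top_of_permMap_mem hinv ⟨_, isLyapunovLike_id, rfl⟩
    ⟨_, isLyapunovLike_projection hadd hc, rfl⟩ hij

end Permutation

/-! ### Cones of maximal Lyapunov rank -/

section Orthant

variable {n : ℕ} {K : PointedCone ℝ (EuclideanSpace ℝ (Fin n))}

/-- The cone generated by a basis of `ℝⁿ` is isomorphic to the nonnegative orthant. -/
theorem isIsomorphic_nonnegOrthant (b : Module.Basis (Fin n) ℝ (EuclideanSpace ℝ (Fin n)))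
    (hK : K = PointedCone.hull ℝ (Set.range b)) : IsIsomorphic K (nonnegOrthant n) := by
  refine ⟨b.equivFun.trans (WithLp.linearEquiv 2 ℝ (Fin n → ℝ)).symm, ?_⟩
  ext y
  constructor
  · rintro ⟨x, hx, rfl⟩ i
    change 0 ≤ b.repr x i
    have hx' : x ∈ K := hx
    rw [hK] at hx'
    clear hx
    induction hx' using Submodule.span_induction with
    | mem x hx =>
      obtain ⟨j, rfl⟩ := hx
      rw [b.repr_self, Finsupp.single_apply]
      split_ifs <;> simp
    | zero => simp
    | add x y _ _ hx hy =>
      rw [map_add]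
      exact add_nonneg hx hy
    | smul c x _ hx =>
      change 0 ≤ b.repr ((c : ℝ) • x) i
      rw [map_smul]
      exact mul_nonneg c.2 hx
  · intro hy
    refine ⟨∑ i, y i • b i, ?_, ?_⟩
    · rw [hK]
      exact sum_mem fun i _ => PointedCone.smul_mem _ (hy i)
        (Submodule.subset_span (Set.mem_range_self i))
    · ext i
      change b.equivFun (∑ i, y i • b i) i = y i
      rw [← b.equivFun_symm_apply, LinearEquiv.apply_symm_apply]

/-- A proper polyhedral cone in `ℝⁿ` whose Lyapunov rank is at least `n` has Lyapunov rank `n` and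
is isomorphic to the nonnegative orthant. -/
theorem IsProper.isIsomorphic_nonnegOrthant_of_le_lyapunovRank (hK : IsProper K)
    (hP : IsPolyhedral K) (hn : n ≤ lyapunovRank K) :
    IsIsomorphic K (nonnegOrthant n) ∧ lyapunovRank K = n := by
  classical
  obtain ⟨S, hS, hmin⟩ := hP.exists_minimal_generators
  have hspan := hK.span_eq_top_of_hull hS
  have hSK : ∀ x ∈ S, x ∈ K := fun x hx => hS ▸ Submodule.subset_span hx
  have hne : ∀ x ∈ S, x ≠ 0 := fun x hx h0 => hmin x hx (h0 ▸ Submodule.zero_mem _)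
  obtain ⟨b, hb⟩ : ∃ b : Module.Basis (Fin n) ℝ (EuclideanSpace ℝ (Fin n)), ∀ i, b i ∈ S := by
    let b₀ := Module.Basis.ofSpan hspan.ge
    refine ⟨b₀.reindex (b₀.indexEquiv (EuclideanSpace.basisFun (Fin n) ℝ).toBasis), fun i => ?_⟩
    rw [Module.Basis.reindex_apply]
    exact Module.Basis.ofSpan_subset hspan.ge (Set.mem_range_self _)
  -- `Φ` reads off the diagonal of `L` in the basis `b`. As each `b i` is an eigenvector, the
  -- diagonal determines `L`; the rank hypothesis then makes every diagonal occur.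
  let Φ : lyapunovLike K →ₗ[ℝ] (Fin n → ℝ) := LinearMap.pi fun i =>
    b.coord i ∘ₗ LinearMap.applyₗ (b i) ∘ₗ (lyapunovLike K).subtype
  have hΦ : ∀ (L : lyapunovLike K) i, L.1 (b i) = Φ L i • b i := by
    intro L i
    obtain ⟨μ, hμ⟩ := hK.exists_eigenvalue hS (hb i) (hmin _ (hb i)) L.2
    have : Φ L i = μ := by
      change b.repr (L.1 (b i)) i = μ
      simp [hμ]
    rw [this, hμ]
  have hinj : Function.Injective Φ := by
    intro L M h
    refine Subtype.ext (b.ext fun i => ?_)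
    rw [hΦ, hΦ, h]
  have hrank : lyapunovRank K = n := by
    refine le_antisymm ?_ hn
    simpa [lyapunovRank] using LinearMap.finrank_le_finrank_of_injective hinj
  have hsurj : Function.Surjective Φ :=
    (LinearMap.injective_iff_surjective_of_finrank_eq_finrank (by
      simpa [lyapunovRank] using hrank)).1 hinj
  refine ⟨isIsomorphic_nonnegOrthant b (le_antisymm ?_ ?_), hrank⟩
  · rw [hS]
    refine Submodule.span_le.2 fun x hx => ?_
    obtain ⟨i, hi⟩ : ∃ i, b.repr x i ≠ 0 := by
      by_contra! h
      exact hne x hx (b.repr.map_eq_zero_iff.1 (Finsupp.ext h))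
    -- This `L` is the coordinate projection onto the line of `b i`. The generator `x` is an
    -- eigenvector with nonzero image, so it lies on that line.
    obtain ⟨L, hL⟩ := hsurj (Pi.single i 1)
    have hLx : L.1 x = b.repr x i • b i := by
      conv_lhs => rw [← b.sum_repr x]
      rw [map_sum, Finset.sum_eq_single i]
      · rw [map_smul, hΦ, hL]; simp
      · intro j _ hj
        rw [map_smul, hΦ, hL]; simp [hj]
      · simp
    obtain ⟨μ, hμ⟩ := hK.exists_eigenvalue hS hx (hmin x hx) L.2
    rw [hLx] at hμ
    have hμ0 : μ ≠ 0 := by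
      rintro rfl
      rw [zero_smul, smul_eq_zero] at hμ
      exact hμ.elim hi (b.ne_zero i)
    have hxb : x = (μ⁻¹ * b.repr x i) • b i := by
      rw [mul_smul, hμ, inv_smul_smul₀ hμ0]
    have hbi : b i ∈ PointedCone.hull ℝ (Set.range b) :=
      Submodule.subset_span (Set.mem_range_self i)
    rcases le_or_gt 0 (μ⁻¹ * b.repr x i) with hc | hc
    · rw [hxb]
      exact PointedCone.smul_mem _ hc hbi
    · refine absurd (hK.eq_zero_of_neg_mem (hSK x hx) ?_) (hne x hx)
      rw [hxb, ← neg_smul]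
      exact PointedCone.smul_mem _ (by linarith) (hSK _ (hb i))
  · refine Submodule.span_le.2 ?_
    rintro _ ⟨i, rfl⟩
    exact hSK _ (hb i)

end Orthant

end PermCone

theorem theorem2 (n : ℕ) (hn : 0 < n) (Q : PointedCone ℝ (EuclideanSpace ℝ (Fin n)))
    (hproper : PermCone.IsProper Q) (hpoly : PermCone.IsPolyhedral Q)
    (hperm : PermCone.IsPermInvariant Q) :
    (PermCone.IsIrreducible Q ∧ PermCone.lyapunovRank Q = 1) ∨
    (PermCone.IsReducible Q ∧ PermCone.IsIsomorphic Q (PermCone.nonnegOrthant n) ∧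
      PermCone.lyapunovRank Q = n) := by
  have : NeZero n := ⟨hn.ne'⟩
  by_cases hred : PermCone.IsReducible Q
  · refine Or.inr ⟨hred, hproper.isIsomorphic_nonnegOrthant_of_le_lyapunovRank hpoly ?_⟩
    -- Evaluation at the all-ones vector maps the Lyapunov-like maps onto ℝⁿ, so their dimension is
    -- at least `n`.
    have htop := hperm.map_lyapunovLike_ones_eq_top hproper hred
    have hle := Submodule.finrank_map_le (LinearMap.applyₗ (PermCone.ones n))
      (PermCone.lyapunovLike Q)
    rw [htop, finrank_top, finrank_euclideanSpace_fin] at hle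
    exact hle
  · refine Or.inl ⟨⟨fun hbot => ?_, hred⟩, hproper.lyapunovRank_eq_one hpoly hred⟩
    -- The zero cone does not span ℝⁿ, because `n` is positive.
    have htop := hproper.span_eq_top
    rw [hbot, Submodule.bot_coe, Submodule.span_zero_singleton] at htop
    exact bot_ne_top htop
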